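/- For integers $\ell\ge 1$ and $n\ge 0$, let $T_\ell(n)$ denote the number of $\ell$-regular partition triples of $n$, i.e. the number of triples $(\lambda_1,\lambda_2,\lambda_3)$ of partitions whose parts sum to $n$ in total and none of which has a part divisible by $\ell$; equivalently, $$\sum_{n\ge 0} T_\ell(n)q^n=\prod_{m\ge 1}\frac{(1-q^{\ell m})^3}{(1-q^m)^3}.$$ **Theorem 1.2.** For all integers $n,\alpha,\beta\ge 0$ we have $$T_{3^{2\alpha+2}}\left(3^{2\alpha+\beta+1}(n+1)-\frac{3^{2\alpha+2}-1}{8}\right)\equiv 0\pmod{3^{3\alpha+2\beta+2}}$$ and $$T_{3^{2\alpha+2}}\left(3^{2\alpha+\beta+1}(3n+2)-\frac{3^{2\alpha+2}-1}{8}\right)\equiv 0\pmod{3^{3\alpha+2\beta+3}}.$$ In particular, the conjecture of Baruah and Das holds: for all integers $l,n\ge 0$ and $k\ge 1$, $$T_{3^{2k}}\left(3^{l+2k-1}n+3^{l+2k-1}-\frac{3^{2k}-1}{8}\right)\equiv 0\pmod{3^{3k+2l-1}}.$$ -/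

import Mathlib

/-- The finite set of all `ℓ`-regular partition triples of `n`: a triple of sizes
`s = (s 0, s 1, s 2)` of natural numbers with sum `n`, together with, for each `i`, a partition of
`s i` none of whose parts is divisible by `ℓ`. -/
def regularPartitionTriples (ℓ n : ℕ) :
    Finset (Σ s : Fin 3 → ℕ, ∀ i : Fin 3, Nat.Partition (s i)) :=
  (Finset.Nat.antidiagonalTuple 3 n).sigma fun s =>
    Fintype.piFinset fun i => Nat.Partition.restricted (s i) (fun part => ¬ ℓ ∣ part)

/-- `T ℓ n` is the number of `ℓ`-regular partition triples of `n`. -/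
def T (ℓ n : ℕ) : ℕ := (regularPartitionTriples ℓ n).card

/-! Write `E` for Euler's product, `U` for `dissect 0`, `t` for `hauptmodulNine`, `x` for
`hauptmodulThree` and `G a` for `tripleSeries a`. The values of `T` in question are coefficients of
`U^(2a+b+1) (G a)`.

Jacobi's identity for `E³` gives the 3-dissection `E(q)³ = A(q³) - 3q E(q⁹)³`. Multiplying its
conjugates under `q ↦ ωq`, with `ω³ = 1`, gives `cubic_relation`, hence `x = t(1 + 9t + 27t²)` and
`t³ = x(q³)(1 + 9t + 27t²)`. The latter is a recurrence for `U(t^i)`. In the variables `3t` and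
`27x` it shows that `U` maps `x ℤ[27x]` into `9x ℤ[27x]` and `t x ℤ[27x]` into `3x ℤ[27x]`.

Since `G (a+1) = t · G a (q⁹)`, one has `U²(f · G (a+1)) = U²(f t) · G a`. Raising `a` by one thus
costs two applications of `U` and gains `27`, while each further `U` gains `9`; so `U^(2a+b+1) (G
a)` lies in `3^(3a+2b+2) x ℤ[27x]` (`dissect_pow_add_tripleSeries`). The extra `3` at indices `3n+2`
appears because elements of `x ℤ[27x]` are, modulo `3`, constant multiples of `t`, whose
coefficients there are divisible by `3`. The conjecture is the first congruence with `α = k - 1` and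
`β = l`. -/

open PowerSeries

namespace RegularTriples

/-! ### Finite form of Jacobi's identity -/

section Jacobi

variable {S : Type*} [CommRing S]

/-- The finite product `(1 - q) (1 - q ^ 2) ⋯ (1 - q ^ n)`. -/
def qFactorial (q : S) (n : ℕ) : S := ∏ i ∈ Finset.range n, (1 - q ^ (i + 1))

theorem qFactorial_succ (q : S) (n : ℕ) :
    qFactorial q (n + 1) = qFactorial q n * (1 - q ^ (n + 1)) :=
  Finset.prod_range_succ _ _

/-- Triangular numbers `0, 1, 3, 6, …`. -/
def triangular (j : ℕ) : ℕ := ∑ i ∈ Finset.range (j + 1), i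

theorem triangular_succ (j : ℕ) : triangular (j + 1) = triangular j + (j + 1) :=
  Finset.sum_range_succ _ _

theorem two_mul_triangular (j : ℕ) : 2 * triangular j = j * (j + 1) := by
  induction j with
  | zero => simp [triangular]
  | succ j ih => rw [triangular_succ, mul_add, ih]; ring

theorem le_triangular (j : ℕ) : j ≤ triangular j := by
  have := two_mul_triangular j
  nlinarith [Nat.zero_le j, Nat.le_mul_self j]

/-- The coefficients of the finite form of Jacobi's identity for the cube of Euler's product:
a signed power of `q` times a Gaussian binomial coefficient, where `r n` is the inverse of
`qFactorial q n`. -/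
def jacobiTerm (q : S) (r : ℕ → S) (n j : ℕ) : S :=
  (-1) ^ j * q ^ triangular j * qFactorial q (2 * n + 1) * r (n + j + 1) *
    if j ≤ n then r (n - j) else 0

variable {q : S} {r : ℕ → S}

theorem inverse_qFactorial_succ (hr : ∀ n, qFactorial q n * r n = 1) (n : ℕ) :
    r n = (1 - q ^ (n + 1)) * r (n + 1) := by
  have h1 := hr n
  have h2 := hr (n + 1)
  rw [qFactorial_succ] at h2
  linear_combination (-r n) * h2 + (1 - q ^ (n + 1)) * r (n + 1) * h1

/-- Boundary case of the recurrence `jacobiTerm_succ_succ`: the reflection `j ↦ -1 - j` changes the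
sign of the terms, so the term at `-1` is minus the term at `0`. -/
theorem jacobiTerm_succ_zero (hr : ∀ n, qFactorial q n * r n = 1) (n : ℕ) :
    jacobiTerm q r (n + 1) 0 = (1 + q ^ (2 * n + 2)) * jacobiTerm q r n 0
      - q ^ (n + 1) * (jacobiTerm q r n 1 - jacobiTerm q r n 0) := by
  have hP : qFactorial q (2 * (n + 1) + 1) =
      qFactorial q (2 * n + 1) * (1 - q ^ (2 * n + 2)) * (1 - q ^ (2 * n + 3)) := by
    rw [show 2 * (n + 1) + 1 = 2 * n + 1 + 1 + 1 by ring, qFactorial_succ, qFactorial_succ]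
  have e1 := inverse_qFactorial_succ hr n
  have e2 := inverse_qFactorial_succ hr (n + 1)
  have t1 : triangular 1 = 1 := by decide
  have t0 : triangular 0 = 0 := by decide
  rcases n with _ | n
  · simp only [jacobiTerm, hP, t0, t1] at *
    simp only [zero_add, Nat.reduceAdd, Nat.reduceLeDiff, if_true, if_false, Nat.sub_zero] at *
    rw [e1, e2]
    ring
  · have e0 := inverse_qFactorial_succ hr n
    simp only [jacobiTerm, hP, t0, t1, if_true, Nat.le_add_left, Nat.sub_zero,
      add_zero, Nat.add_sub_cancel]
    rw [e0, e1, e2]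
    ring

/-- As `1 + q^(2n+2) = (1 - q^(n+1))² + 2q^(n+1)`, passing from `n` to `n + 1` multiplies by the
factor that `qFactorial q n ^ 2` gains and subtracts `q^(n+1)` times a second difference in `j`. The
weights `2j + 1`, being linear, cancel the second difference on summation. -/
theorem jacobiTerm_succ_succ (hr : ∀ n, qFactorial q n * r n = 1) (n j : ℕ) :
    jacobiTerm q r (n + 1) (j + 1) = (1 + q ^ (2 * n + 2)) * jacobiTerm q r n (j + 1)
      - q ^ (n + 1) * (jacobiTerm q r n j + jacobiTerm q r n (j + 2)) := by
  have hP : qFactorial q (2 * (n + 1) + 1) =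
      qFactorial q (2 * n + 1) * (1 - q ^ (2 * n + 2)) * (1 - q ^ (2 * n + 3)) := by
    rw [show 2 * (n + 1) + 1 = 2 * n + 1 + 1 + 1 by ring, qFactorial_succ, qFactorial_succ]
  have e1 := inverse_qFactorial_succ hr (n + j + 1)
  have e2 := inverse_qFactorial_succ hr (n + j + 1 + 1)
  have i1 : n + 1 + (j + 1) + 1 = n + j + 1 + 1 + 1 := by ring
  have i2 : n + (j + 1) + 1 = n + j + 1 + 1 := by ring
  have i3 : n + (j + 2) + 1 = n + j + 1 + 1 + 1 := by ring
  simp only [jacobiTerm, hP, triangular_succ, i1, i2, i3]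
  rcases lt_trichotomy n j with h | rfl | h
  · simp [show ¬ (j + 1 ≤ n + 1) by lia, show ¬ (j + 1 ≤ n) by lia, show ¬ (j ≤ n) by lia,
      show ¬ (j + 2 ≤ n) by lia]
  · simp only [le_refl, if_true, Nat.not_succ_le_self, if_false, Nat.sub_self,
      show ¬ (n + 2 ≤ n) by lia]
    rw [e1, e2]
    ring
  · obtain ⟨k, rfl⟩ := Nat.exists_eq_add_of_lt h
    simp only [show j + 1 ≤ j + k + 1 + 1 by lia, show j + 1 ≤ j + k + 1 by lia,
      show j ≤ j + k + 1 by lia, if_true, show j + k + 1 + 1 - (j + 1) = k + 1 by lia,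
      show j + k + 1 - (j + 1) = k by lia, show j + k + 1 - j = k + 1 by lia]
    have e3 := inverse_qFactorial_succ hr k
    rcases k with _ | k
    · simp only [show ¬ (j + 2 ≤ j + 0 + 1) by lia, if_false]
      rw [e1, e2, e3]
      ring
    · have e4 := inverse_qFactorial_succ hr k
      simp only [show j + 2 ≤ j + (k + 1) + 1 by lia, if_true,
        show j + (k + 1) + 1 - (j + 2) = k by lia]
      rw [e1, e2, e4, e3]
      ring

theorem jacobiTerm_of_lt {n j : ℕ} (h : n < j) : jacobiTerm q r n j = 0 := by
  simp [jacobiTerm, h.not_ge]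

/-- Summation by parts behind the induction step of `sq_qFactorial_eq_sum`. -/
theorem sum_odd_mul_second_difference (c : ℕ → S) (N : ℕ) :
    c 0 - c 1 + c 0 + ∑ j ∈ Finset.range N, (2 * ((j + 1 : ℕ) : S) + 1) *
      (2 * c (j + 1) - c j - c (j + 2))
      = (2 * N + 3) * c N - (2 * N + 1) * c (N + 1) - c 0 := by
  induction N with
  | zero => simp; ring
  | succ N ih =>
    rw [Finset.sum_range_succ, ← add_assoc, ih]
    push_cast
    ring

/-- A finite form of Jacobi's identity for the cube of Euler's product. -/
theorem sq_qFactorial_eq_sum (hr : ∀ n, qFactorial q n * r n = 1) (n : ℕ) :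
    qFactorial q n ^ 2 = ∑ j ∈ Finset.range (n + 1), (2 * (j : S) + 1) * jacobiTerm q r n j := by
  induction n with
  | zero =>
    have h0 := hr 0
    have h1 := hr 1
    have t0 : triangular 0 = 0 := by decide
    simp only [qFactorial, Finset.range_zero, Finset.prod_empty, one_mul] at h0
    simp [jacobiTerm, t0, h0, qFactorial] at h1 ⊢
    exact h1.symm
  | succ n ih =>
    rw [Finset.sum_range_succ']
    simp only [jacobiTerm_succ_succ hr, jacobiTerm_succ_zero hr]
    have key := sum_odd_mul_second_difference (jacobiTerm q r n) (n + 1)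
    have ih' : qFactorial q n ^ 2 =
        ∑ j ∈ Finset.range (n + 1), (2 * ((j + 1 : ℕ) : S) + 1) * jacobiTerm q r n (j + 1)
          + jacobiTerm q r n 0 := by
      rw [ih, Finset.sum_range_succ', Finset.sum_range_succ,
        jacobiTerm_of_lt (Nat.lt_succ_self n)]
      simp
    rw [jacobiTerm_of_lt (Nat.lt_succ_self n), jacobiTerm_of_lt (show n < n + 1 + 1 by lia)] at key
    have split : ∑ j ∈ Finset.range (n + 1), (2 * ((j + 1 : ℕ) : S) + 1) *
        ((1 + q ^ (2 * n + 2)) * jacobiTerm q r n (j + 1)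
          - q ^ (n + 1) * (jacobiTerm q r n j + jacobiTerm q r n (j + 2)))
        = (1 - q ^ (n + 1)) ^ 2 * ∑ j ∈ Finset.range (n + 1),
            (2 * ((j + 1 : ℕ) : S) + 1) * jacobiTerm q r n (j + 1)
          + q ^ (n + 1) * ∑ j ∈ Finset.range (n + 1), (2 * ((j + 1 : ℕ) : S) + 1) *
            (2 * jacobiTerm q r n (j + 1) - jacobiTerm q r n j - jacobiTerm q r n (j + 2)) := by
      rw [Finset.mul_sum, Finset.mul_sum, ← Finset.sum_add_distrib]
      refine Finset.sum_congr rfl fun j _ => ?_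
      ring
    rw [split, qFactorial_succ, mul_pow, ih']
    push_cast at key ⊢
    linear_combination (-q ^ (n + 1)) * key

end Jacobi

/-! ### Euler's product as a convergent infinite product -/

open PowerSeries.WithPiTopology in
theorem continuous_of_continuous_coeff {Y R : Type*} [TopologicalSpace Y] [Semiring R]
    [TopologicalSpace R] {f : Y → R⟦X⟧} (h : ∀ n, Continuous fun y => coeff n (f y)) :
    Continuous f := by
  rw [continuous_iff_continuousAt]
  intro y
  rw [ContinuousAt, tendsto_iff_coeff_tendsto]
  exact fun n => (h n).continuousAt

section Expand

open PowerSeries.WithPiTopology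

variable {R : Type*} [CommRing R] [TopologicalSpace R]

theorem continuous_expand (k : ℕ) (hk : k ≠ 0) :
    Continuous (expand k hk : R⟦X⟧ → R⟦X⟧) := by
  refine continuous_of_continuous_coeff fun n => ?_
  simp only [coeff_expand]
  split_ifs
  · exact continuous_coeff R _
  · exact continuous_const

theorem continuous_rescale [IsTopologicalRing R] (a : R) :
    Continuous (rescale a : R⟦X⟧ → R⟦X⟧) := by
  refine continuous_of_continuous_coeff fun n => ?_
  simp only [coeff_rescale]
  exact continuous_const.mul (continuous_coeff R _)

end Expand

/-- Euler's product `(1 - X) (1 - X ^ 2) (1 - X ^ 3) ⋯` as a power series. -/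
noncomputable def euler (R : Type*) [CommRing R] : R⟦X⟧ := pentagonalSeries R

section Product

open PowerSeries.WithPiTopology

variable (R : Type*) [CommRing R] [TopologicalSpace R]

theorem hasProd_euler : HasProd (fun n => (1 - X ^ (n + 1) : R⟦X⟧)) (euler R) :=
  hasProd_one_sub_X_pow R

theorem hasProd_expand_euler (k : ℕ) (hk : k ≠ 0) :
    HasProd (fun n => (1 - X ^ (k * (n + 1)) : R⟦X⟧)) (expand k hk (euler R)) := by
  have h := (hasProd_euler R).map (expand k hk) (continuous_expand k hk)
  refine h.congr_fun fun n => ?_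
  simp [pow_mul]

/-- The factors of `expand k (euler R)` spread over all indices. -/
theorem hasProd_expand_euler_ite (k : ℕ) (hk : k ≠ 0) :
    HasProd (fun n => if k ∣ n + 1 then (1 - X ^ (n + 1) : R⟦X⟧) else 1)
      (expand k hk (euler R)) := by
  have hk' := Nat.pos_of_ne_zero hk
  have key : ∀ n : ℕ, k * (n + 1) - 1 + 1 = k * (n + 1) := fun n =>
    Nat.sub_add_cancel (Nat.mul_pos hk' n.succ_pos)
  have hinj : Function.Injective fun n : ℕ => k * (n + 1) - 1 := by
    intro a b hab
    have := key a
    have h2 := key b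
    simp only at hab
    rw [hab, h2] at this
    have := Nat.eq_of_mul_eq_mul_left hk' this
    lia
  rw [← hinj.hasProd_iff]
  · refine (hasProd_expand_euler R k hk).congr_fun fun n => ?_
    simp [Function.comp, key]
  · intro n hn
    rw [if_neg]
    rintro ⟨c, hc⟩
    refine hn ⟨c - 1, ?_⟩
    rcases c with _ | c
    · simp at hc
    · simp only [Nat.add_sub_cancel]
      lia

end Product

/-! ### Passage to the limit in Jacobi's identity -/

theorem coeff_qFactorial_eq (k n : ℕ) (h : k ≤ n) :
    coeff k (qFactorial (X : ℤ⟦X⟧) n) = coeff k (qFactorial (X : ℤ⟦X⟧) k) := by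
  induction n, h using Nat.le_induction with
  | base => rfl
  | succ n hn ih =>
    rw [qFactorial_succ, mul_sub, mul_one, map_sub, ih, coeff_mul_X_pow', if_neg (by lia), sub_zero]

open PowerSeries.WithPiTopology in
theorem coeff_qFactorial_eq_coeff_euler (k n : ℕ) (h : k ≤ n) :
    coeff k (qFactorial (X : ℤ⟦X⟧) n) = coeff k (euler ℤ) := by
  have h1 := (hasProd_euler ℤ).tendsto_prod_nat
  rw [tendsto_iff_coeff_tendsto] at h1
  have h2 := (h1 k).eventually (by
    rw [nhds_discrete]; exact Filter.mem_pure.2 rfl : ∀ᶠ z in nhds (coeff k (euler ℤ)),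
      z = coeff k (euler ℤ))
  obtain ⟨m, hm, hkm⟩ := (h2.and (Filter.eventually_ge_atTop k)).exists
  rw [coeff_qFactorial_eq k n h, ← coeff_qFactorial_eq k m hkm]
  exact hm

theorem constantCoeff_euler : constantCoeff (euler ℤ) = 1 := by
  rw [← coeff_zero_eq_constantCoeff_apply, ← coeff_qFactorial_eq_coeff_euler 0 0 le_rfl]
  simp [qFactorial]

theorem X_pow_dvd_qFactorial_sub_euler (d n : ℕ) (h : d ≤ n) :
    (X : ℤ⟦X⟧) ^ (d + 1) ∣ qFactorial X n - euler ℤ := by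
  rw [X_pow_dvd_iff]
  intro m hm
  rw [map_sub, coeff_qFactorial_eq_coeff_euler m n (by lia), sub_self]

theorem constantCoeff_qFactorial (n : ℕ) : constantCoeff (qFactorial (X : ℤ⟦X⟧) n) = 1 := by
  simp [qFactorial]

/-- Jacobi's identity for the cube of Euler's product, modulo a power of `X`. -/
theorem X_pow_dvd_euler_cube_sub (d : ℕ) :
    (X : ℤ⟦X⟧) ^ (d + 1) ∣ euler ℤ ^ 3 -
      ∑ j ∈ Finset.range (2 * d + 1), (2 * (j : ℤ⟦X⟧) + 1) * ((-1) ^ j * X ^ triangular j) := by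
  set I := Ideal.span {(X : ℤ⟦X⟧) ^ (d + 1)}
  rw [← Ideal.mem_span_singleton, ← Ideal.Quotient.eq]
  set φ := Ideal.Quotient.mk I
  have hX : ∀ m, d < m → φ (X ^ m) = 0 := fun m hm =>
    Ideal.Quotient.eq_zero_iff_mem.2 (Ideal.mem_span_singleton.2 (pow_dvd_pow _ hm))
  have hP : ∀ m, d ≤ m → φ (qFactorial X m) = φ (euler ℤ) := fun m hm =>
    Ideal.Quotient.eq.2 (Ideal.mem_span_singleton.2 (X_pow_dvd_qFactorial_sub_euler d m hm))
  set r : ℕ → ℤ⟦X⟧ := fun n => invOfUnit (qFactorial X n) 1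
  have hr : ∀ n, qFactorial X n * r n = 1 := fun n =>
    mul_invOfUnit _ _ (by rw [constantCoeff_qFactorial]; rfl)
  have hφr : ∀ m, d ≤ m → φ (euler ℤ) * φ (r m) = 1 := fun m hm => by
    rw [← hP m hm, ← map_mul, hr, map_one]
  -- With `n = 2d`, a term that survives modulo `X^(d+1)` has `j ≤ triangular j ≤ d`, so all indices
  -- `2d - j`, `2d + j + 1` and `4d + 1` are at least `d` and each finite product may be replaced by
  -- Euler's.
  have key := congrArg φ (sq_qFactorial_eq_sum hr (2 * d))
  have : φ (euler ℤ ^ 3) = φ (qFactorial X (2 * d) ^ 2) * φ (euler ℤ) := by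
    rw [map_pow, map_pow, hP (2 * d) (by lia)]; ring
  rw [this, key, map_sum, map_sum, Finset.sum_mul]
  refine Finset.sum_congr rfl fun j hj => ?_
  have hj' : j ≤ 2 * d := by simpa [Nat.lt_succ_iff] using hj
  rw [map_mul, map_mul, mul_assoc]
  congr 1
  rw [jacobiTerm, if_pos hj']
  simp only [map_mul]
  rcases lt_or_ge d (triangular j) with h | h
  · simp [hX _ h]
  · have hjd : j ≤ d := (le_triangular j).trans h
    have h1 := hφr (2 * d + j + 1) (by lia)
    have h2 := hφr (2 * d - j) (by lia)
    rw [hP (2 * (2 * d) + 1) (by lia)]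
    linear_combination φ ((-1) ^ j) * φ (X ^ triangular j) * h2 +
      φ ((-1) ^ j) * φ (X ^ triangular j) * φ (r (2 * d - j)) * φ (euler ℤ) * h1

theorem coeff_euler_cube (d : ℕ) : coeff d (euler ℤ ^ 3) =
    ∑ j ∈ Finset.range (2 * d + 1), if d = triangular j then (2 * (j : ℤ) + 1) * (-1) ^ j else 0 := by
  have h := X_pow_dvd_iff.1 (X_pow_dvd_euler_cube_sub d) d (Nat.lt_succ_self d)
  rw [map_sub, sub_eq_zero] at h
  rw [h, map_sum]
  refine Finset.sum_congr rfl fun j _ => ?_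
  have : (2 * (j : ℤ⟦X⟧) + 1) * ((-1) ^ j * X ^ triangular j) =
      C ((2 * (j : ℤ) + 1) * (-1) ^ j) * X ^ triangular j := by
    simp; ring
  rw [this, coeff_C_mul, coeff_X_pow]
  split_ifs <;> simp

theorem triangular_strictMono : StrictMono triangular :=
  strictMono_nat_of_lt_succ fun j => by rw [triangular_succ]; lia

/-- **Jacobi's identity**: the coefficients of the cube of Euler's product at triangular numbers. -/
theorem coeff_euler_cube_triangular (j : ℕ) :
    coeff (triangular j) (euler ℤ ^ 3) = (2 * (j : ℤ) + 1) * (-1) ^ j := by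
  rw [coeff_euler_cube, Finset.sum_eq_single j]
  · simp
  · intro i _ hi
    rw [if_neg fun h => hi (triangular_strictMono.injective h).symm]
  · intro h
    have := le_triangular j
    simp at h
    lia

/-- **Jacobi's identity**: the cube of Euler's product is supported on triangular numbers. -/
theorem coeff_euler_cube_of_not_triangular {d : ℕ} (h : ∀ j, d ≠ triangular j) :
    coeff d (euler ℤ ^ 3) = 0 := by
  rw [coeff_euler_cube]
  exact Finset.sum_eq_zero fun j _ => if_neg (h j)

/-! ### Triangular numbers modulo 3 -/

theorem triangular_three_mul_add_one (m : ℕ) :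
    triangular (3 * m + 1) = 9 * triangular m + 1 := by
  have h1 := two_mul_triangular (3 * m + 1)
  have h2 := two_mul_triangular m
  nlinarith

theorem coeff_euler_cube_three_mul_add_two (n : ℕ) : coeff (3 * n + 2) (euler ℤ ^ 3) = 0 := by
  refine coeff_euler_cube_of_not_triangular fun j hj => ?_
  have h := two_mul_triangular j
  rw [← hj] at h
  have h3 : (2 * (3 * n + 2)) % 3 = (j * (j + 1)) % 3 := by rw [h]
  rw [Nat.mul_mod j] at h3
  have : j % 3 = 0 ∨ j % 3 = 1 ∨ j % 3 = 2 := by lia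
  rcases this with h | h | h <;> simp [Nat.add_mod, h] at h3 <;> lia

theorem exists_eq_of_triangular_eq {j n : ℕ} (h : 3 * n + 1 = triangular j) :
    ∃ m, j = 3 * m + 1 ∧ n = 3 * triangular m := by
  have h2 := two_mul_triangular j
  rw [← h] at h2
  have h3 : (2 * (3 * n + 1)) % 3 = (j * (j + 1)) % 3 := by rw [h2]
  rw [Nat.mul_mod j] at h3
  have h4 : j % 3 = 1 := by
    have : j % 3 = 0 ∨ j % 3 = 1 ∨ j % 3 = 2 := by lia
    rcases this with h | h | h <;> simp [Nat.add_mod, h] at h3 ⊢ <;> lia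
  refine ⟨j / 3, by lia, ?_⟩
  have : j = 3 * (j / 3) + 1 := by lia
  rw [this, triangular_three_mul_add_one] at h
  lia

/-- Only `j = 3m + 1` contributes. There `2j + 1 = 3(2m + 1)` and the sign `(-1)^j` is opposite to
`(-1)^m`, so Jacobi's series reappears with factor `-3`. -/
theorem coeff_euler_cube_three_mul_add_one (n : ℕ) : coeff (3 * n + 1) (euler ℤ ^ 3) =
    -3 * coeff n (expand 3 three_ne_zero (euler ℤ ^ 3)) := by
  by_cases h : ∃ j, 3 * n + 1 = triangular j
  · obtain ⟨j, hj⟩ := h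
    obtain ⟨m, rfl, rfl⟩ := exists_eq_of_triangular_eq hj
    rw [hj, coeff_euler_cube_triangular, coeff_expand_mul, coeff_euler_cube_triangular]
    push_cast
    rw [pow_succ, pow_mul]
    ring
  · push Not at h
    rw [coeff_euler_cube_of_not_triangular h, coeff_expand]
    split_ifs with h3
    · obtain ⟨k, rfl⟩ := h3
      rw [Nat.mul_div_cancel_left _ three_pos, coeff_euler_cube_of_not_triangular, mul_zero]
      rintro m rfl
      refine h (3 * m + 1) ?_
      rw [triangular_three_mul_add_one]
      ring
    · simp

/-! ### The 3-dissection of power series and of `E³` -/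

/-- The power series of the coefficients of `f` at indices congruent to `i` modulo `3`. For `i = 0`
this is Atkin's operator `U₃`. -/
noncomputable def dissect (i : ℕ) : ℤ⟦X⟧ →ₗ[ℤ] ℤ⟦X⟧ where
  toFun f := mk fun n => coeff (3 * n + i) f
  map_add' f g := by ext n; simp
  map_smul' c f := by ext n; simp only [coeff_mk, map_zsmul, RingHom.id_apply]

@[simp]
theorem coeff_dissect (i n : ℕ) (f : ℤ⟦X⟧) : coeff n (dissect i f) = coeff (3 * n + i) f := by
  simp [dissect]

/-- The substitution of `X ^ 3` for `X`. -/
noncomputable def cubeVar : ℤ⟦X⟧ →ₐ[ℤ] ℤ⟦X⟧ := expand 3 three_ne_zero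

theorem coeff_cubeVar (n : ℕ) (f : ℤ⟦X⟧) :
    coeff n (cubeVar f) = if 3 ∣ n then coeff (n / 3) f else 0 :=
  coeff_expand 3 three_ne_zero f

theorem dissect_X_pow_mul_cubeVar (i a : ℕ) (hi : i < 3) (ha : a < 3) (f : ℤ⟦X⟧) :
    dissect i (X ^ a * cubeVar f) = if a = i then f else 0 := by
  ext n
  rw [coeff_dissect, coeff_X_pow_mul', coeff_cubeVar]
  by_cases h : a = i
  · subst h
    simp [show 3 * n + a - a = 3 * n by lia]
  · rw [if_neg h, map_zero]
    split_ifs with h1 h2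
    · omega
    · rfl
    · rfl

theorem eq_sum_dissect (f : ℤ⟦X⟧) : f = X ^ 0 * cubeVar (dissect 0 f) +
    X ^ 1 * cubeVar (dissect 1 f) + X ^ 2 * cubeVar (dissect 2 f) := by
  ext n
  simp only [map_add, coeff_X_pow_mul', coeff_cubeVar, coeff_dissect]
  have : n % 3 = 0 ∨ n % 3 = 1 ∨ n % 3 = 2 := by lia
  rcases this with h | h | h
  · simp only [Nat.zero_le, if_true, Nat.sub_zero, show 3 ∣ n by lia]
    rw [show 3 * (n / 3) + 0 = n by lia]
    split_ifs <;> first | (exfalso; lia) | simp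
  · rw [if_pos (Nat.zero_le _), if_neg (show ¬ 3 ∣ n - 0 by lia), if_pos (show 1 ≤ n by lia),
      if_pos (show 3 ∣ n - 1 by lia), show 3 * ((n - 1) / 3) + 1 = n by lia]
    split_ifs <;> first | (exfalso; lia) | simp
  · rw [if_pos (Nat.zero_le _), if_neg (show ¬ 3 ∣ n - 0 by lia), if_pos (show 1 ≤ n by lia),
      if_neg (show ¬ 3 ∣ n - 1 by lia), if_pos (show 2 ≤ n by lia),
      if_pos (show 3 ∣ n - 2 by lia), show 3 * ((n - 2) / 3) + 2 = n by lia]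
    simp

theorem dissect_cubeVar_mul (i : ℕ) (hi : i < 3) (f g : ℤ⟦X⟧) :
    dissect i (cubeVar f * g) = f * dissect i g := by
  have h : cubeVar f * g = X ^ 0 * cubeVar (f * dissect 0 g) +
      X ^ 1 * cubeVar (f * dissect 1 g) + X ^ 2 * cubeVar (f * dissect 2 g) := by
    conv_lhs => rw [eq_sum_dissect g]
    simp only [map_mul]
    ring
  rw [h, map_add, map_add, dissect_X_pow_mul_cubeVar i 0 hi (by lia),
    dissect_X_pow_mul_cubeVar i 1 hi (by lia), dissect_X_pow_mul_cubeVar i 2 hi (by lia)]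
  interval_cases i <;> simp

theorem cubeVar_injective : Function.Injective cubeVar := by
  intro f g h
  have := congrArg (dissect 0) h
  rwa [← mul_one (cubeVar f), ← mul_one (cubeVar g), dissect_cubeVar_mul 0 (by lia),
    dissect_cubeVar_mul 0 (by lia), show dissect 0 (1 : ℤ⟦X⟧) = 1 by
      simpa using dissect_X_pow_mul_cubeVar 0 0 (by lia) (by lia) 1, mul_one, mul_one] at this

/-- The `3`-dissection of the cube of Euler's product. -/
theorem euler_cube_eq : euler ℤ ^ 3 = cubeVar (dissect 0 (euler ℤ ^ 3)) -
    3 * X * cubeVar (cubeVar (euler ℤ ^ 3)) := by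
  conv_lhs => rw [eq_sum_dissect (euler ℤ ^ 3)]
  have h2 : dissect 2 (euler ℤ ^ 3) = 0 := by
    ext n; rw [coeff_dissect, coeff_euler_cube_three_mul_add_two, map_zero]
  have h1 : dissect 1 (euler ℤ ^ 3) = -3 * cubeVar (euler ℤ ^ 3) := by
    ext n
    rw [coeff_dissect, coeff_euler_cube_three_mul_add_one,
      show (-3 : ℤ⟦X⟧) = C (-3) by simp, coeff_C_mul]
    rfl
  rw [h1, h2]
  simp only [map_mul, map_neg, map_ofNat, map_zero]
  ring

/-! ### Norms over the cube roots of unity and the cubic relation -/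

open PowerSeries.WithPiTopology in
theorem map_euler : PowerSeries.map (Int.castRingHom ℂ) (euler ℤ) = euler ℂ := by
  have hc : Continuous (PowerSeries.map (Int.castRingHom ℂ) : ℤ⟦X⟧ → ℂ⟦X⟧) := by
    refine continuous_of_continuous_coeff fun n => ?_
    simp only [coeff_map]
    exact continuous_of_discreteTopology.comp (continuous_coeff ℤ n)
  have h := (hasProd_euler ℤ).map (PowerSeries.map (Int.castRingHom ℂ)) hc
  refine HasProd.unique (h.congr_fun fun n => ?_) (hasProd_euler ℂ)
  simp

open PowerSeries.WithPiTopology in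
/-- The norm of Euler's product from `ℂ⟦X⟧` to `ℂ⟦X ^ 3⟧`. -/
theorem norm_euler {ω : ℂ} (hω : ω ^ 3 = 1) (hω1 : ω ≠ 1) :
    euler ℂ * rescale ω (euler ℂ) * rescale (ω ^ 2) (euler ℂ) *
      expand 3 three_ne_zero (expand 3 three_ne_zero (euler ℂ)) =
    expand 3 three_ne_zero (euler ℂ) ^ 4 := by
  have h0 := hasProd_euler ℂ
  have hr : ∀ a : ℂ, HasProd (fun n => (1 - (C a * X) ^ (n + 1) : ℂ⟦X⟧)) (rescale a (euler ℂ)) :=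
    fun a => (h0.map (rescale a) (continuous_rescale a)).congr_fun fun n => by simp [rescale_X]
  have h9 : HasProd (fun n => if 3 ∣ n + 1 then (1 - (X ^ (n + 1)) ^ 3 : ℂ⟦X⟧) else 1)
      (expand 3 three_ne_zero (expand 3 three_ne_zero (euler ℂ))) := by
    refine ((hasProd_expand_euler_ite ℂ 3 three_ne_zero).map (expand 3 three_ne_zero)
      (continuous_expand 3 three_ne_zero)).congr_fun fun n => ?_
    simp only [Function.comp]
    split_ifs <;> simp [← pow_mul, mul_comm]
  have hl := ((h0.mul (hr ω)).mul (hr (ω ^ 2))).mul h9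
  have h3 := hasProd_expand_euler ℂ 3 three_ne_zero
  have h3' := hasProd_expand_euler_ite ℂ 3 three_ne_zero
  have hR := h3.mul ((h3'.mul h3').mul h3')
  -- One of the four copies keeps its factor `1 - y³`, `y = X^(n+1)`, at every index `n`; the other
  -- three are spread over the indices with `3 ∣ n + 1`. The two sides then agree factor by factor.
  rw [show expand 3 three_ne_zero (euler ℂ) ^ 4 = expand 3 three_ne_zero (euler ℂ) *
    (expand 3 three_ne_zero (euler ℂ) * expand 3 three_ne_zero (euler ℂ) *
      expand 3 three_ne_zero (euler ℂ)) by ring]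
  refine HasProd.unique (hl.congr_fun fun n => ?_) hR
  have hq : 1 + ω + ω ^ 2 = 0 := by
    have : (ω - 1) * (1 + ω + ω ^ 2) = 0 := by linear_combination hω
    exact (mul_eq_zero.1 this).resolve_left (sub_ne_zero.2 hω1)
  simp only [mul_pow, ← map_pow]
  rw [show (X : ℂ⟦X⟧) ^ (3 * (n + 1)) = (X ^ (n + 1)) ^ 3 by rw [← pow_mul, mul_comm]]
  generalize (X : ℂ⟦X⟧) ^ (n + 1) = y
  split_ifs with h
  · obtain ⟨k, hk⟩ := h
    have e1 : ω ^ (n + 1) = 1 := by rw [hk, pow_mul, hω, one_pow]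
    have e2 : (ω ^ 2) ^ (n + 1) = 1 := by rw [← pow_mul, mul_comm, pow_mul, e1, one_pow]
    rw [e1, e2, map_one]
    ring
  · have e1 : ∃ w : ℂ, ω ^ (n + 1) = w ∧ (ω ^ 2) ^ (n + 1) = w ^ 2 ∧ 1 + w + w ^ 2 = 0 := by
      refine ⟨_, rfl, by rw [← pow_mul, ← pow_mul, mul_comm], ?_⟩
      have hm : n + 1 = 3 * ((n + 1) / 3) + (n + 1) % 3 := by lia
      have : (n + 1) % 3 = 1 ∨ (n + 1) % 3 = 2 := by lia
      rw [hm, pow_add, pow_mul, hω, one_pow, one_mul]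
      rcases this with h | h <;> rw [h]
      · simpa using hq
      · linear_combination hq + ω * hω
    obtain ⟨w, e1, e2, e3⟩ := e1
    rw [e1, e2]
    have e4 : 1 + (C w : ℂ⟦X⟧) + C w ^ 2 = 0 := by
      rw [← map_pow, ← map_one (C (R := ℂ)), ← map_add, ← map_add, e3, map_zero]
    rw [map_pow]
    linear_combination (y - y ^ 2 * C w + y ^ 3 * (C w - 1)) * e4

theorem rescale_expand_three {ω : ℂ} (hω : ω ^ 3 = 1) (f : ℂ⟦X⟧) :
    rescale ω (expand 3 three_ne_zero f) = expand 3 three_ne_zero f := by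
  ext n
  rw [coeff_rescale, coeff_expand]
  split_ifs with h
  · obtain ⟨k, rfl⟩ := h
    rw [pow_mul, hω, one_pow, one_mul]
  · simp

/-- The cubic relation between the components of the `3`-dissection of the cube of Euler's
product. -/
theorem cubic_relation :
    (cubeVar (dissect 0 (euler ℤ ^ 3)) ^ 3 - 27 * X ^ 3 * cubeVar (cubeVar (euler ℤ ^ 3)) ^ 3) *
      cubeVar (cubeVar (euler ℤ)) ^ 3 = cubeVar (euler ℤ) ^ 12 := by
  set φ := PowerSeries.map (Int.castRingHom ℂ)
  have hφ : Function.Injective φ := map_injective _ Int.cast_injective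
  have hφe : ∀ f, φ (cubeVar f) = expand 3 three_ne_zero (φ f) := fun f => map_expand _ _ _ _
  obtain ⟨ω, hω⟩ : ∃ ω : ℂ, IsPrimitiveRoot ω 3 := ⟨_, Complex.isPrimitiveRoot_exp 3 three_ne_zero⟩
  have h3 := hω.pow_eq_one
  have h1 := hω.ne_one (by norm_num)
  have hn := norm_euler h3 h1
  have hd := congrArg φ euler_cube_eq
  apply hφ
  simp only [map_mul, map_sub, map_pow, hφe, map_ofNat, φ, map_X, map_euler] at hd ⊢
  set a := expand 3 three_ne_zero (PowerSeries.map (Int.castRingHom ℂ) (dissect 0 (euler ℤ ^ 3)))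
    with ha
  set b := expand 3 three_ne_zero (expand 3 three_ne_zero (euler ℂ)) with hb
  have hra : ∀ w : ℂ, w ^ 3 = 1 → rescale w (euler ℂ) ^ 3 = a - 3 * (C w * X) * b ^ 3 := by
    intro w hw
    rw [← map_pow, hd]
    simp only [map_sub, map_mul, map_pow, map_ofNat, rescale_X, ha, hb, rescale_expand_three hw]
  have hw2 : (ω ^ 2) ^ 3 = 1 := by rw [← pow_mul, mul_comm, pow_mul, h3, one_pow]
  have e1 := hra ω h3
  have e2 := hra (ω ^ 2) hw2
  have hq : 1 + ω + ω ^ 2 = 0 := by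
    have : (ω - 1) * (1 + ω + ω ^ 2) = 0 := by linear_combination h3
    exact (mul_eq_zero.1 this).resolve_left (sub_ne_zero.2 h1)
  have e4 : 1 + (C ω : ℂ⟦X⟧) + C ω ^ 2 = 0 := by
    rw [← map_pow, ← map_one (C (R := ℂ)), ← map_add, ← map_add, hq, map_zero]
  -- The cube of `norm_euler`: its first three factors become the conjugates `a - 3wXb³` for `w = 1,
  -- ω, ω²`, with product `a³ - 27X³b⁹`.
  rw [show expand 3 three_ne_zero (euler ℂ) ^ 12 = (expand 3 three_ne_zero (euler ℂ) ^ 4) ^ 3 by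
    ring, ← hn, mul_pow, mul_pow, mul_pow, hd, e1, e2, map_pow]
  generalize C ω = w at *
  have e5 : w ^ 3 = 1 := by linear_combination (w - 1) * e4
  have e6 : (a - 3 * X * b ^ 3) * (a - 3 * (w * X) * b ^ 3) * (a - 3 * (w ^ 2 * X) * b ^ 3) =
      a ^ 3 - 27 * X ^ 3 * (b ^ 3) ^ 3 := by
    linear_combination (-3 * a ^ 2 * X * b ^ 3 + 9 * a * X ^ 2 * (b ^ 3) ^ 2 * w) * e4
      - 27 * X ^ 3 * (b ^ 3) ^ 3 * e5
  rw [e6]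

/-! ### Generating function of regular partition triples -/

section GeneratingFunction

open PowerSeries.WithPiTopology

theorem mk_card_restricted_mul_euler (l : ℕ) (hl : l ≠ 0) :
    (PowerSeries.mk fun n => ((Nat.Partition.restricted n (¬ l ∣ ·)).card : ℤ)) * euler ℤ =
      expand l hl (euler ℤ) := by
  have h := (Nat.Partition.hasProd_powerSeriesMk_card_restricted ℤ (¬ l ∣ ·)).mul (hasProd_euler ℤ)
  refine HasProd.unique (h.congr_fun fun n => ?_) (hasProd_expand_euler_ite ℤ l hl)
  by_cases hn : l ∣ n + 1
  · simp [hn]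
  · simp only [hn, not_false_iff, if_true, if_false, pow_mul]
    exact (tsum_pow_mul_one_sub_of_constantCoeff_eq_zero (by simp)).symm

end GeneratingFunction

theorem coeff_mk_pow_three (a : ℕ → ℤ) (n : ℕ) : coeff n (PowerSeries.mk a ^ 3) =
    ∑ s ∈ Finset.Nat.antidiagonalTuple 3 n, ∏ i, a (s i) := by
  have h := coeff_prod (fun _ : Fin 3 => PowerSeries.mk a) n Finset.univ
  rw [Finset.prod_const, Finset.card_univ, Fintype.card_fin] at h
  rw [h]
  refine Finset.sum_bij (fun s _ => s) ?_ ?_ ?_ ?_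
  · intro s hs
    rw [Finset.Nat.mem_antidiagonalTuple]
    exact (Finset.mem_finsuppAntidiag.1 hs).1
  · intro s _ t _ hst
    exact DFunLike.coe_injective hst
  · intro s hs
    refine ⟨Finsupp.equivFunOnFinite.symm s, ?_, rfl⟩
    rw [Finset.mem_finsuppAntidiag]
    exact ⟨by simpa using Finset.Nat.mem_antidiagonalTuple.1 hs, Finset.subset_univ _⟩
  · intro s _
    simp

theorem card_regularPartitionTriples (l n : ℕ) : T l n =
    ∑ s ∈ Finset.Nat.antidiagonalTuple 3 n,
      ∏ i, (Nat.Partition.restricted (s i) (¬ l ∣ ·)).card := by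
  rw [T, regularPartitionTriples, Finset.card_sigma]
  exact Finset.sum_congr rfl fun s _ => Fintype.card_piFinset _

/-- The generating function of regular partition triples. -/
theorem mk_T_mul_euler_cube (l : ℕ) (hl : l ≠ 0) :
    (PowerSeries.mk fun n => (T l n : ℤ)) * euler ℤ ^ 3 = expand l hl (euler ℤ) ^ 3 := by
  rw [← mk_card_restricted_mul_euler l hl, mul_pow]
  congr 1
  ext n
  rw [coeff_mk_pow_three, coeff_mk, card_regularPartitionTriples]
  push_cast
  rfl

/-! ### The Hauptmoduln of levels 9 and 3 and their two relations -/

/-- The inverse of Euler's product. -/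
noncomputable def eulerInv : ℤ⟦X⟧ := invOfUnit (euler ℤ) 1

theorem euler_mul_eulerInv : euler ℤ * eulerInv = 1 :=
  mul_invOfUnit _ _ (by rw [constantCoeff_euler]; rfl)

theorem euler_ne_zero : euler ℤ ≠ 0 := left_ne_zero_of_mul_eq_one euler_mul_eulerInv

/-- The `q`-expansion of the Hauptmodul `η(9τ)³ / η(τ)³`. -/
noncomputable def hauptmodulNine : ℤ⟦X⟧ := X * cubeVar (cubeVar (euler ℤ)) ^ 3 * eulerInv ^ 3

/-- The `q`-expansion of the Hauptmodul `η(3τ)¹² / η(τ)¹²`. -/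
noncomputable def hauptmodulThree : ℤ⟦X⟧ := X * cubeVar (euler ℤ) ^ 12 * eulerInv ^ 12

theorem hauptmodulNine_mul_euler_cube :
    hauptmodulNine * euler ℤ ^ 3 = X * cubeVar (cubeVar (euler ℤ)) ^ 3 := by
  have h : euler ℤ ^ 3 * eulerInv ^ 3 = 1 := by rw [← mul_pow, euler_mul_eulerInv, one_pow]
  rw [hauptmodulNine]
  linear_combination X * cubeVar (cubeVar (euler ℤ)) ^ 3 * h

theorem hauptmodulThree_mul_euler_pow :
    hauptmodulThree * euler ℤ ^ 12 = X * cubeVar (euler ℤ) ^ 12 := by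
  have h : euler ℤ ^ 12 * eulerInv ^ 12 = 1 := by rw [← mul_pow, euler_mul_eulerInv, one_pow]
  rw [hauptmodulThree]
  linear_combination X * cubeVar (euler ℤ) ^ 12 * h

/-- With `w = E³` and `B = E(q⁹)³`, the dissection reads `A = w + 3qB` and `tw = qB`. Hence `A³ -
27q³B³ = w³(1 + 9t + 27t²)`, and `cubic_relation` evaluates the left side. -/
theorem hauptmodulThree_eq : hauptmodulThree =
    hauptmodulNine * (1 + 9 * hauptmodulNine + 27 * hauptmodulNine ^ 2) := by
  have ht := hauptmodulNine_mul_euler_cube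
  have hx := hauptmodulThree_mul_euler_pow
  have hE := euler_cube_eq
  have hc := cubic_relation
  rw [map_pow cubeVar (euler ℤ), map_pow cubeVar] at hE hc
  apply mul_right_cancel₀ (pow_ne_zero 12 euler_ne_zero)
  rw [hx, ← hc]
  generalize cubeVar (dissect 0 (euler ℤ ^ 3)) = a at *
  generalize cubeVar (cubeVar (euler ℤ)) = b at *
  generalize hauptmodulNine = t at *
  rw [show euler ℤ ^ 12 = (euler ℤ ^ 3) ^ 4 by ring]
  generalize euler ℤ ^ 3 = w at *
  have h : a = w + 3 * X * b ^ 3 := by linear_combination -hE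
  rw [h, show t * (1 + 9 * t + 27 * t ^ 2) * w ^ 4 =
    (t * w) * (w ^ 3 + 9 * (t * w) * w ^ 2 + 27 * (t * w) ^ 2 * w) by ring, ht]
  ring

theorem cubeVar_hauptmodulThree_mul :
    cubeVar hauptmodulThree * (cubeVar (dissect 0 (euler ℤ ^ 3)) ^ 3 -
      27 * X ^ 3 * cubeVar (cubeVar (euler ℤ ^ 3)) ^ 3) =
    X ^ 3 * cubeVar (cubeVar (euler ℤ ^ 3)) ^ 3 := by
  have hx := congrArg cubeVar hauptmodulThree_mul_euler_pow
  have hc := cubic_relation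
  simp only [map_mul, map_pow] at hx hc ⊢
  have hX : cubeVar X = X ^ 3 := expand_X 3 three_ne_zero
  have hb : cubeVar (cubeVar (euler ℤ)) ≠ 0 := fun h =>
    euler_ne_zero (cubeVar_injective (cubeVar_injective (by rw [h, map_zero, map_zero])))
  rw [hX, ← hc] at hx
  apply mul_right_cancel₀ (pow_ne_zero 3 hb)
  linear_combination hx

theorem hauptmodulNine_cube : hauptmodulNine ^ 3 =
    cubeVar hauptmodulThree * (1 + 9 * hauptmodulNine + 27 * hauptmodulNine ^ 2) := by
  have ht := hauptmodulNine_mul_euler_cube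
  have hx := cubeVar_hauptmodulThree_mul
  have hE := euler_cube_eq
  rw [map_pow cubeVar (euler ℤ), map_pow cubeVar] at hE hx
  have h0 : euler ℤ ^ 3 ≠ 0 := pow_ne_zero 3 euler_ne_zero
  generalize cubeVar (dissect 0 (euler ℤ ^ 3)) = a at *
  generalize cubeVar (cubeVar (euler ℤ)) = b at *
  generalize hauptmodulNine = t at *
  generalize cubeVar hauptmodulThree = x at *
  generalize euler ℤ ^ 3 = w at *
  apply mul_right_cancel₀ (pow_ne_zero 3 h0)
  have h : a = w + 3 * X * b ^ 3 := by linear_combination -hE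
  rw [h] at hx
  rw [show x * (1 + 9 * t + 27 * t ^ 2) * w ^ 3 =
    x * (w ^ 3 + 9 * (t * w) * w ^ 2 + 27 * (t * w) ^ 2 * w) by ring, ← mul_pow, ht]
  linear_combination -hx

/-! ### The 3-dissection of the level 9 Hauptmodul -/

/-- The common denominator of the components of the `3`-dissection of `hauptmodulNine`. -/
noncomputable def dissectDenom : ℤ⟦X⟧ :=
  dissect 0 (euler ℤ ^ 3) ^ 3 - 27 * X * cubeVar (euler ℤ ^ 3) ^ 3

theorem cubeVar_dissectDenom : cubeVar dissectDenom =
    cubeVar (dissect 0 (euler ℤ ^ 3)) ^ 3 - 27 * X ^ 3 * cubeVar (cubeVar (euler ℤ ^ 3)) ^ 3 := by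
  have hX : cubeVar X = X ^ 3 := expand_X 3 three_ne_zero
  simp only [dissectDenom, map_sub, map_mul, map_pow, map_ofNat, hX]

theorem dissectDenom_mul : dissectDenom * cubeVar (euler ℤ) ^ 3 = euler ℤ ^ 12 := by
  apply cubeVar_injective
  rw [map_mul, cubeVar_dissectDenom, map_pow cubeVar (cubeVar _), cubic_relation,
    map_pow cubeVar (euler ℤ)]

theorem dissectDenom_ne_zero : dissectDenom ≠ 0 := by
  intro h
  have := dissectDenom_mul
  rw [h, zero_mul] at this
  exact pow_ne_zero 12 euler_ne_zero this.symm

theorem hauptmodulThree_mul_dissectDenom :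
    dissectDenom * hauptmodulThree = X * cubeVar (euler ℤ ^ 3) ^ 3 := by
  apply cubeVar_injective
  have hX : cubeVar X = X ^ 3 := expand_X 3 three_ne_zero
  have := cubeVar_hauptmodulThree_mul
  rw [map_mul, cubeVar_dissectDenom, mul_comm, this, map_mul, hX, map_pow cubeVar (cubeVar _)]

/-- Rationalises `t = qB / (A - 3qB)` through `A³ - (3qB)³`, a series in `q³`. The numerator is then
sorted by exponents modulo 3. -/
theorem cubeVar_dissectDenom_mul_hauptmodulNine : cubeVar dissectDenom * hauptmodulNine =
    X * cubeVar (cubeVar (euler ℤ ^ 3)) * (cubeVar (dissect 0 (euler ℤ ^ 3)) ^ 2 +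
      3 * X * cubeVar (dissect 0 (euler ℤ ^ 3)) * cubeVar (cubeVar (euler ℤ ^ 3)) +
      9 * X ^ 2 * cubeVar (cubeVar (euler ℤ ^ 3)) ^ 2) := by
  have ht := hauptmodulNine_mul_euler_cube
  have hE := euler_cube_eq
  rw [cubeVar_dissectDenom]
  rw [← map_pow, ← map_pow] at ht
  have h0 : euler ℤ ^ 3 ≠ 0 := pow_ne_zero 3 euler_ne_zero
  generalize cubeVar (dissect 0 (euler ℤ ^ 3)) = a at *
  generalize cubeVar (cubeVar (euler ℤ ^ 3)) = b at *
  generalize hauptmodulNine = t at *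
  generalize euler ℤ ^ 3 = w at *
  apply mul_right_cancel₀ h0
  have h : a = w + 3 * X * b := by linear_combination -hE
  rw [h]
  linear_combination ((w + 3 * X * b) ^ 3 - 27 * X ^ 3 * b ^ 3) * ht

theorem dissect_X_pow_three_mul_cubeVar (i a : ℕ) (hi : i < 3) (ha : a < 3) (k : ℕ) (f : ℤ⟦X⟧) :
    dissect i (X ^ (3 * k + a) * cubeVar f) = if a = i then X ^ k * f else 0 := by
  have hX : cubeVar X = X ^ 3 := expand_X 3 three_ne_zero
  rw [show X ^ (3 * k + a) * cubeVar f = X ^ a * cubeVar (X ^ k * f) by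
    rw [map_mul, map_pow, hX]; ring, dissect_X_pow_mul_cubeVar i a hi ha]

theorem dissect_zero_hauptmodulNine : dissect 0 hauptmodulNine = 9 * hauptmodulThree := by
  apply mul_left_cancel₀ dissectDenom_ne_zero
  rw [← dissect_cubeVar_mul 0 (by lia), cubeVar_dissectDenom_mul_hauptmodulNine]
  have hx := hauptmodulThree_mul_dissectDenom
  generalize dissect 0 (euler ℤ ^ 3) = a at *
  generalize cubeVar (euler ℤ ^ 3) = b at *
  have : X * cubeVar b * (cubeVar a ^ 2 + 3 * X * cubeVar a * cubeVar b +
      9 * X ^ 2 * cubeVar b ^ 2) = X ^ (3 * 0 + 1) * cubeVar (b * a ^ 2) +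
      X ^ (3 * 0 + 2) * cubeVar (3 * a * b ^ 2) + X ^ (3 * 1 + 0) * cubeVar (9 * b ^ 3) := by
    simp only [map_mul, map_pow, map_ofNat]
    ring
  rw [this]
  simp only [map_add]
  rw [dissect_X_pow_three_mul_cubeVar 0 1 (by lia) (by lia),
    dissect_X_pow_three_mul_cubeVar 0 2 (by lia) (by lia),
    dissect_X_pow_three_mul_cubeVar 0 0 (by lia) (by lia)]
  simp only [one_ne_zero, OfNat.ofNat_ne_zero, if_false, if_true]
  linear_combination -9 * hx

theorem dissect_zero_hauptmodulNine_sq :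
    dissect 0 (hauptmodulNine ^ 2) = 6 * hauptmodulThree + 243 * hauptmodulThree ^ 2 := by
  apply mul_left_cancel₀ (pow_ne_zero 2 dissectDenom_ne_zero)
  rw [← dissect_cubeVar_mul 0 (by lia), map_pow, ← mul_pow, cubeVar_dissectDenom_mul_hauptmodulNine]
  have hx := hauptmodulThree_mul_dissectDenom
  have hd : dissectDenom = dissect 0 (euler ℤ ^ 3) ^ 3 - 27 * X * cubeVar (euler ℤ ^ 3) ^ 3 := rfl
  generalize dissect 0 (euler ℤ ^ 3) = a at *
  generalize cubeVar (euler ℤ ^ 3) = b at *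
  have : (X * cubeVar b * (cubeVar a ^ 2 + 3 * X * cubeVar a * cubeVar b +
      9 * X ^ 2 * cubeVar b ^ 2)) ^ 2 = X ^ (3 * 0 + 2) * cubeVar (b ^ 2 * a ^ 4) +
      X ^ (3 * 1 + 0) * cubeVar (6 * a ^ 3 * b ^ 3) +
      X ^ (3 * 1 + 1) * cubeVar (27 * a ^ 2 * b ^ 4) +
      X ^ (3 * 1 + 2) * cubeVar (54 * a * b ^ 5) +
      X ^ (3 * 2 + 0) * cubeVar (81 * b ^ 6) := by
    simp only [map_mul, map_pow, map_ofNat]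
    ring
  rw [this]
  simp only [map_add]
  rw [dissect_X_pow_three_mul_cubeVar 0 2 (by lia) (by lia),
    dissect_X_pow_three_mul_cubeVar 0 0 (by lia) (by lia),
    dissect_X_pow_three_mul_cubeVar 0 1 (by lia) (by lia),
    dissect_X_pow_three_mul_cubeVar 0 2 (by lia) (by lia),
    dissect_X_pow_three_mul_cubeVar 0 0 (by lia) (by lia)]
  simp only [one_ne_zero, OfNat.ofNat_ne_zero, if_false, if_true]
  -- Eliminating `a³` in favour of `dissectDenom` turns the numerator into a polynomial in `X * b³ =
  -- dissectDenom * hauptmodulThree`.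
  have ha : a ^ 3 = dissectDenom + 27 * X * b ^ 3 := by rw [hd]; ring
  rw [show dissectDenom ^ 2 * (6 * hauptmodulThree + 243 * hauptmodulThree ^ 2) =
    6 * dissectDenom * (dissectDenom * hauptmodulThree) +
      243 * (dissectDenom * hauptmodulThree) ^ 2 by ring, hx, ha]
  ring

theorem three_dvd_dissect_two_hauptmodulNine : 3 ∣ dissect 2 hauptmodulNine := by
  have hd : dissectDenom * (cubeVar (euler ℤ) ^ 3 * eulerInv ^ 12) = 1 := by
    rw [← mul_assoc, dissectDenom_mul, ← mul_pow, euler_mul_eulerInv, one_pow]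
  have : 3 ∣ dissectDenom * dissect 2 hauptmodulNine := by
    rw [← dissect_cubeVar_mul 2 (by lia), cubeVar_dissectDenom_mul_hauptmodulNine]
    generalize dissect 0 (euler ℤ ^ 3) = a at *
    generalize cubeVar (euler ℤ ^ 3) = b at *
    have : X * cubeVar b * (cubeVar a ^ 2 + 3 * X * cubeVar a * cubeVar b +
        9 * X ^ 2 * cubeVar b ^ 2) = X ^ (3 * 0 + 1) * cubeVar (b * a ^ 2) +
        X ^ (3 * 0 + 2) * cubeVar (3 * a * b ^ 2) + X ^ (3 * 1 + 0) * cubeVar (9 * b ^ 3) := by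
      simp only [map_mul, map_pow, map_ofNat]
      ring
    rw [this]
    simp only [map_add]
    rw [dissect_X_pow_three_mul_cubeVar 2 1 (by lia) (by lia),
      dissect_X_pow_three_mul_cubeVar 2 2 (by lia) (by lia),
      dissect_X_pow_three_mul_cubeVar 2 0 (by lia) (by lia)]
    simp [mul_assoc]
  have h := this.mul_left (cubeVar (euler ℤ) ^ 3 * eulerInv ^ 12)
  rwa [← mul_assoc, mul_comm _ dissectDenom, hd, one_mul] at h

/-! ### `U` on polynomials in the Hauptmoduln -/

theorem dissect_zero_natCast_mul (k : ℕ) (f : ℤ⟦X⟧) : dissect 0 (k * f) = k * dissect 0 f := by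
  rw [← nsmul_eq_mul, map_nsmul, nsmul_eq_mul]

theorem natCast_ne_zero {k : ℕ} (hk : k ≠ 0) : (k : ℤ⟦X⟧) ≠ 0 := fun h => by
  simpa [hk] using congrArg constantCoeff h

/-- For `T = 3t`, `hauptmodulNine_cube` reads `T³ = 27x(q³)(1 + 3T + 3T²)`, and `27x(q³)` leaves `U`
as `27x`. This gives a three-term recurrence with integral coefficients. -/
theorem dissect_zero_three_mul_hauptmodulNine_pow (i : ℕ) : ∃ p : Polynomial ℤ,
    dissect 0 ((3 * hauptmodulNine) ^ (i + 1)) =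
      27 * hauptmodulThree * Polynomial.aeval (27 * hauptmodulThree) p := by
  have h1 : dissect 0 (3 * hauptmodulNine) = 27 * hauptmodulThree := by
    have := dissect_zero_natCast_mul 3 hauptmodulNine
    push_cast at this
    rw [this, dissect_zero_hauptmodulNine]
    ring
  have h2 : dissect 0 ((3 * hauptmodulNine) ^ 2) =
      27 * hauptmodulThree * (2 + 3 * (27 * hauptmodulThree)) := by
    have := dissect_zero_natCast_mul 9 (hauptmodulNine ^ 2)
    push_cast at this
    rw [show (3 * hauptmodulNine) ^ 2 = 9 * hauptmodulNine ^ 2 by ring, this,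
      dissect_zero_hauptmodulNine_sq]
    ring
  have hrec : ∀ j : ℕ, dissect 0 ((3 * hauptmodulNine) ^ (j + 3)) = 27 * hauptmodulThree *
      (dissect 0 ((3 * hauptmodulNine) ^ j) + 3 * dissect 0 ((3 * hauptmodulNine) ^ (j + 1)) +
        3 * dissect 0 ((3 * hauptmodulNine) ^ (j + 2))) := by
    intro j
    have h3 := dissect_zero_natCast_mul 3
    push_cast at h3
    rw [← h3, ← h3, ← map_add, ← map_add, ← dissect_cubeVar_mul 0 (by lia)]
    congr 1
    simp only [map_mul, map_ofNat]
    linear_combination 27 * (3 * hauptmodulNine) ^ j * hauptmodulNine_cube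
  have h0 : dissect 0 (1 : ℤ⟦X⟧) = 1 := by
    simpa using dissect_X_pow_mul_cubeVar 0 0 (by lia) (by lia) 1
  induction i using Nat.strong_induction_on with
  | _ i ih =>
    match i with
    | 0 => exact ⟨1, by simpa using h1⟩
    | 1 => exact ⟨2 + 3 * Polynomial.X, by rw [h2]; simp only [map_add, map_mul, map_ofNat, Polynomial.aeval_X]⟩
    -- Here the recurrence reaches `U(1) = 1`, which the induction hypothesis does not cover.
    | 2 =>
      obtain ⟨p, hp⟩ := ih 0 (by lia)
      obtain ⟨r, hr⟩ := ih 1 (by lia)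
      refine ⟨1 + 3 * (Polynomial.X * p) + 3 * (Polynomial.X * r), ?_⟩
      rw [hrec 0, hp, hr, pow_zero, h0]
      simp only [map_add, map_mul, map_one, map_ofNat, Polynomial.aeval_X]
    | i + 3 =>
      obtain ⟨p, hp⟩ := ih i (by lia)
      obtain ⟨r, hr⟩ := ih (i + 1) (by lia)
      obtain ⟨s, hs⟩ := ih (i + 2) (by lia)
      refine ⟨Polynomial.X * p + 3 * (Polynomial.X * r) + 3 * (Polynomial.X * s), ?_⟩
      rw [show i + 3 + 1 = i + 1 + 3 by ring, hrec (i + 1), hp, hr, hs]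
      simp only [map_add, map_mul, map_ofNat, Polynomial.aeval_X]

theorem dissect_zero_three_mul_hauptmodulNine_mul_aeval (p : Polynomial ℤ) :
    ∃ r : Polynomial ℤ,
      dissect 0 (3 * hauptmodulNine * Polynomial.aeval (3 * hauptmodulNine) p) =
        27 * hauptmodulThree * Polynomial.aeval (27 * hauptmodulThree) r := by
  induction p using Polynomial.induction_on' with
  | add p q hp hq =>
    obtain ⟨r, hr⟩ := hp
    obtain ⟨s, hs⟩ := hq
    exact ⟨r + s, by rw [map_add, mul_add, map_add, hr, hs, map_add, mul_add]⟩
  | monomial n a =>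
    obtain ⟨r, hr⟩ := dissect_zero_three_mul_hauptmodulNine_pow n
    refine ⟨a • r, ?_⟩
    rw [Polynomial.aeval_monomial, map_zsmul, mul_smul_comm, ← hr, ← map_zsmul]
    congr 1
    simp
    ring

theorem aeval_hauptmodulThree (p : Polynomial ℤ) :
    Polynomial.aeval (27 * hauptmodulThree) p = Polynomial.aeval (3 * hauptmodulNine)
      (p.comp (9 * Polynomial.X * (1 + 3 * Polynomial.X + 3 * Polynomial.X ^ 2))) := by
  rw [Polynomial.aeval_comp, hauptmodulThree_eq]
  congr 2
  simp only [map_add, map_mul, map_one, map_pow, map_ofNat, Polynomial.aeval_X]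
  ring

/-- Atkin's operator `U₃` gains a factor `9` on multiples of the Hauptmodul of level `3`. -/
theorem dissect_zero_hauptmodulThree_mul_aeval (p : Polynomial ℤ) : ∃ r : Polynomial ℤ,
    dissect 0 (hauptmodulThree * Polynomial.aeval (27 * hauptmodulThree) p) =
      9 * (hauptmodulThree * Polynomial.aeval (27 * hauptmodulThree) r) := by
  set c := p.comp (9 * Polynomial.X * (1 + 3 * Polynomial.X + 3 * Polynomial.X ^ 2))
  -- With `T = 3t`, `3x = T(1 + 3T + 3T²)`. After multiplication by `3` the image is a multiple of
  -- `27x`, and cancelling the `3` leaves `9x`.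
  obtain ⟨r, hr⟩ := dissect_zero_three_mul_hauptmodulNine_mul_aeval
    ((1 + 3 * Polynomial.X + 3 * Polynomial.X ^ 2) * c)
  refine ⟨r, mul_left_cancel₀ (natCast_ne_zero (k := 3) (by lia)) ?_⟩
  have h3 := dissect_zero_natCast_mul 3
  push_cast at h3 ⊢
  rw [← h3, show 3 * (9 * (hauptmodulThree * Polynomial.aeval (27 * hauptmodulThree) r)) =
    27 * hauptmodulThree * Polynomial.aeval (27 * hauptmodulThree) r by ring, ← hr,
    aeval_hauptmodulThree]
  congr 1
  simp only [map_mul, map_add, map_one, map_ofNat, map_pow, Polynomial.aeval_X]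
  nth_rewrite 1 [hauptmodulThree_eq]
  ring

theorem dissect_zero_hauptmodulThree_mul_aeval_mul_hauptmodulNine (p : Polynomial ℤ) :
    ∃ r : Polynomial ℤ, dissect 0
        (hauptmodulThree * Polynomial.aeval (27 * hauptmodulThree) p * hauptmodulNine) =
      3 * (hauptmodulThree * Polynomial.aeval (27 * hauptmodulThree) r) := by
  set c := p.comp (9 * Polynomial.X * (1 + 3 * Polynomial.X + 3 * Polynomial.X ^ 2))
  -- Now `9xt = T²(1 + 3T + 3T²)`, so a factor `9` must be cancelled from `27x`, leaving only `3x`.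
  obtain ⟨r, hr⟩ := dissect_zero_three_mul_hauptmodulNine_mul_aeval
    (Polynomial.X * (1 + 3 * Polynomial.X + 3 * Polynomial.X ^ 2) * c)
  refine ⟨r, mul_left_cancel₀ (natCast_ne_zero (k := 9) (by lia)) ?_⟩
  have h9 := dissect_zero_natCast_mul 9
  push_cast at h9 ⊢
  rw [← h9, show 9 * (3 * (hauptmodulThree * Polynomial.aeval (27 * hauptmodulThree) r)) =
    27 * hauptmodulThree * Polynomial.aeval (27 * hauptmodulThree) r by ring, ← hr,
    aeval_hauptmodulThree]
  congr 1
  simp only [map_mul, map_add, map_one, map_ofNat, map_pow, Polynomial.aeval_X]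
  nth_rewrite 1 [hauptmodulThree_eq]
  ring

/-- Modulo `3` only the constant coefficient of `p` survives and `x ≡ t`, so
`three_dvd_dissect_two_hauptmodulNine` applies. -/
theorem three_dvd_coeff_hauptmodulThree_mul_aeval (p : Polynomial ℤ) (n : ℕ) :
    3 ∣ coeff (3 * n + 2) (hauptmodulThree * Polynomial.aeval (27 * hauptmodulThree) p) := by
  obtain ⟨d, hd⟩ := three_dvd_dissect_two_hauptmodulNine
  obtain ⟨f, hf⟩ : ∃ f : ℤ⟦X⟧, hauptmodulThree * Polynomial.aeval (27 * hauptmodulThree) p =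
      p.coeff 0 • hauptmodulNine + (3 : ℤ) • f := by
    have hp := congrArg (Polynomial.aeval (27 * hauptmodulThree)) p.divX_mul_X_add
    rw [map_add, map_mul, Polynomial.aeval_X, Polynomial.aeval_C] at hp
    rw [← hp]
    refine ⟨9 * hauptmodulThree * (Polynomial.aeval (27 * hauptmodulThree) p.divX *
      hauptmodulThree) + p.coeff 0 • (hauptmodulNine * (3 * hauptmodulNine +
        9 * hauptmodulNine ^ 2)), ?_⟩
    simp only [zsmul_eq_mul, eq_intCast]
    push_cast
    linear_combination (p.coeff 0 : ℤ⟦X⟧) * hauptmodulThree_eq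
  rw [hf, map_add, map_zsmul, map_zsmul, ← coeff_dissect, hd,
    show (3 : ℤ⟦X⟧) = C 3 by simp, coeff_C_mul]
  simp only [smul_eq_mul]
  exact dvd_add (Dvd.intro _ (by ring : 3 * (p.coeff 0 * coeff n d) = _)) (dvd_mul_right _ _)

/-! ### Iterating `U` on the generating functions -/

/-- The generating function of regular partition triples for `l = 3 ^ (2 * a + 2)`, shifted so
that it is the `q`-expansion of `η(lτ)³ / η(τ)³`. -/
noncomputable def tripleSeries (a : ℕ) : ℤ⟦X⟧ :=
  X ^ ((3 ^ (2 * a + 2) - 1) / 8) * PowerSeries.mk fun n => (T (3 ^ (2 * a + 2)) n : ℤ)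

theorem coeff_tripleSeries (a n : ℕ) (h : (3 ^ (2 * a + 2) - 1) / 8 ≤ n) :
    coeff n (tripleSeries a) = T (3 ^ (2 * a + 2)) (n - (3 ^ (2 * a + 2) - 1) / 8) := by
  rw [tripleSeries, coeff_X_pow_mul', if_pos h, coeff_mk]

theorem tripleSeries_mul_euler_cube (a : ℕ) : tripleSeries a * euler ℤ ^ 3 =
    X ^ ((3 ^ (2 * a + 2) - 1) / 8) * expand (3 ^ (2 * a + 2)) (by positivity) (euler ℤ) ^ 3 := by
  rw [tripleSeries, mul_assoc, mk_T_mul_euler_cube _ (by positivity)]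

theorem tripleSeries_zero : tripleSeries 0 = hauptmodulNine := by
  apply mul_right_cancel₀ (pow_ne_zero 3 euler_ne_zero)
  rw [tripleSeries_mul_euler_cube, hauptmodulNine_mul_euler_cube]
  have : expand (3 * 3) (by positivity) (euler ℤ) = cubeVar (cubeVar (euler ℤ)) :=
    expand_mul 3 three_ne_zero 3 three_ne_zero (euler ℤ)
  rw [← this]
  norm_num

theorem shift_succ (a : ℕ) :
    (3 ^ (2 * (a + 1) + 2) - 1) / 8 = 9 * ((3 ^ (2 * a + 2) - 1) / 8) + 1 := by
  have h : 3 ^ (2 * a + 2) % 8 = 1 := by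
    rw [show 2 * a + 2 = 2 * (a + 1) by ring, pow_mul, Nat.pow_mod]
    simp
  rw [show 3 ^ (2 * (a + 1) + 2) = 9 * 3 ^ (2 * a + 2) by ring]
  lia

/-- The eta quotient splits as `η(9lτ)³/η(τ)³ = η(9τ)³/η(τ)³ · η(9lτ)³/η(9τ)³`. -/
theorem tripleSeries_succ (a : ℕ) :
    tripleSeries (a + 1) = hauptmodulNine * cubeVar (cubeVar (tripleSeries a)) := by
  have hb : cubeVar (cubeVar (euler ℤ)) ≠ 0 := fun h =>
    euler_ne_zero (cubeVar_injective (cubeVar_injective (by rw [h, map_zero, map_zero])))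
  apply mul_right_cancel₀ (pow_ne_zero 3 euler_ne_zero)
  apply mul_right_cancel₀ (pow_ne_zero 3 hb)
  have h1 := congrArg (fun f => cubeVar (cubeVar f)) (tripleSeries_mul_euler_cube a)
  have h2 : ∀ l m : ℕ, ∀ hl : l ≠ 0, ∀ hm : m ≠ 0, m = 3 * (3 * l) →
      expand m hm (euler ℤ) = cubeVar (cubeVar (expand l hl (euler ℤ))) := by
    rintro l _ hl hm rfl
    rw [expand_mul 3 three_ne_zero (3 * l) (by positivity), expand_mul 3 three_ne_zero l hl]
    rfl
  have hX : cubeVar X = X ^ 3 := expand_X 3 three_ne_zero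
  simp only [map_mul, map_pow, hX] at h1
  rw [tripleSeries_mul_euler_cube, shift_succ,
    h2 (3 ^ (2 * a + 2)) (3 ^ (2 * (a + 1) + 2)) (by positivity) (by positivity) (by ring)]
  have ht := hauptmodulNine_mul_euler_cube
  rw [show hauptmodulNine * cubeVar (cubeVar (tripleSeries a)) * euler ℤ ^ 3 *
      cubeVar (cubeVar (euler ℤ)) ^ 3 = (hauptmodulNine * euler ℤ ^ 3) *
      (cubeVar (cubeVar (tripleSeries a)) * cubeVar (cubeVar (euler ℤ)) ^ 3) by ring, h1, ht]
  ring

theorem dissect_sq_mul_tripleSeries_succ (a : ℕ) (f : ℤ⟦X⟧) :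
    dissect 0 (dissect 0 (f * tripleSeries (a + 1))) =
      dissect 0 (dissect 0 (f * hauptmodulNine)) * tripleSeries a := by
  rw [tripleSeries_succ, show f * (hauptmodulNine * cubeVar (cubeVar (tripleSeries a))) =
    cubeVar (cubeVar (tripleSeries a)) * (f * hauptmodulNine) by ring,
    dissect_cubeVar_mul 0 (by lia), dissect_cubeVar_mul 0 (by lia), mul_comm]

theorem dissect_pow_natCast_mul (k m : ℕ) (f : ℤ⟦X⟧) :
    (dissect 0 ^ k) (m * f) = m * (dissect 0 ^ k) f := by
  rw [← nsmul_eq_mul, map_nsmul, nsmul_eq_mul]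

/-- Each unit of `a` contributes `3` from the `U` that absorbs a factor `t` and `9` from the next;
the last `U` contributes the final `3`. -/
theorem dissect_pow_mul_tripleSeries (a : ℕ) (p : Polynomial ℤ) : ∃ r : Polynomial ℤ,
    (dissect 0 ^ (2 * a + 1))
        (hauptmodulThree * Polynomial.aeval (27 * hauptmodulThree) p * tripleSeries a) =
      (3 ^ (3 * a + 1) : ℕ) *
        (hauptmodulThree * Polynomial.aeval (27 * hauptmodulThree) r) := by
  induction a generalizing p with
  | zero =>
    obtain ⟨r, hr⟩ := dissect_zero_hauptmodulThree_mul_aeval_mul_hauptmodulNine p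
    exact ⟨r, by simpa [tripleSeries_zero] using hr⟩
  | succ a ih =>
    obtain ⟨r, hr⟩ := dissect_zero_hauptmodulThree_mul_aeval_mul_hauptmodulNine p
    obtain ⟨s, hs⟩ := dissect_zero_hauptmodulThree_mul_aeval r
    obtain ⟨u, hu⟩ := ih s
    refine ⟨u, ?_⟩
    have h3 := dissect_zero_natCast_mul 3
    push_cast at h3
    rw [show 2 * (a + 1) + 1 = 2 * a + 1 + 1 + 1 by ring, pow_succ, pow_succ,
      Module.End.mul_apply, Module.End.mul_apply, dissect_sq_mul_tripleSeries_succ, hr, h3, hs]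
    have := dissect_pow_natCast_mul (2 * a + 1) 27
      (hauptmodulThree * Polynomial.aeval (27 * hauptmodulThree) s * tripleSeries a)
    rw [hu] at this
    rw [show 3 * (9 * (hauptmodulThree * Polynomial.aeval (27 * hauptmodulThree) s)) *
      tripleSeries a = (27 : ℕ) * (hauptmodulThree * Polynomial.aeval (27 * hauptmodulThree) s *
        tripleSeries a) by push_cast; ring, this]
    push_cast
    ring

/-- The start is better than in `dissect_pow_mul_tripleSeries`: `U(t) = 9x` gains `9` instead of
`3`, hence the one extra power of `3`. -/
theorem dissect_pow_tripleSeries (a : ℕ) : ∃ r : Polynomial ℤ,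
    (dissect 0 ^ (2 * a + 1)) (tripleSeries a) =
      (3 ^ (3 * a + 2) : ℕ) *
        (hauptmodulThree * Polynomial.aeval (27 * hauptmodulThree) r) := by
  rcases a with _ | a
  · exact ⟨1, by simp [tripleSeries_zero, dissect_zero_hauptmodulNine]⟩
  · obtain ⟨s, hs⟩ := dissect_zero_hauptmodulThree_mul_aeval 1
    obtain ⟨u, hu⟩ := dissect_pow_mul_tripleSeries a s
    refine ⟨u, ?_⟩
    have h9 := dissect_zero_natCast_mul 9
    push_cast at h9
    have h := dissect_sq_mul_tripleSeries_succ a 1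
    rw [map_one, mul_one] at hs
    rw [one_mul, one_mul, dissect_zero_hauptmodulNine, h9, hs] at h
    rw [show 2 * (a + 1) + 1 = 2 * a + 1 + 1 + 1 by ring, pow_succ, pow_succ,
      Module.End.mul_apply, Module.End.mul_apply, h]
    have := dissect_pow_natCast_mul (2 * a + 1) 81
      (hauptmodulThree * Polynomial.aeval (27 * hauptmodulThree) s * tripleSeries a)
    rw [hu] at this
    rw [show 9 * (9 * (hauptmodulThree * Polynomial.aeval (27 * hauptmodulThree) s)) *
      tripleSeries a = (81 : ℕ) * (hauptmodulThree * Polynomial.aeval (27 * hauptmodulThree) s *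
        tripleSeries a) by push_cast; ring, this]
    push_cast
    ring

theorem dissect_pow_add_tripleSeries (a b : ℕ) : ∃ r : Polynomial ℤ,
    (dissect 0 ^ (2 * a + b + 1)) (tripleSeries a) =
      (3 ^ (3 * a + 2 * b + 2) : ℕ) *
        (hauptmodulThree * Polynomial.aeval (27 * hauptmodulThree) r) := by
  induction b with
  | zero => exact dissect_pow_tripleSeries a
  | succ b ih =>
    obtain ⟨r, hr⟩ := ih
    obtain ⟨s, hs⟩ := dissect_zero_hauptmodulThree_mul_aeval r
    refine ⟨s, ?_⟩
    rw [show 2 * a + (b + 1) + 1 = 2 * a + b + 1 + 1 by ring, pow_succ', Module.End.mul_apply, hr,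
      dissect_zero_natCast_mul, hs]
    push_cast
    ring

/-! ### Reading off the congruences -/

theorem coeff_dissect_pow (k n : ℕ) (f : ℤ⟦X⟧) :
    coeff n ((dissect 0 ^ k) f) = coeff (3 ^ k * n) f := by
  induction k generalizing n with
  | zero => simp
  | succ k ih =>
    rw [pow_succ', Module.End.mul_apply, coeff_dissect, ih,
      show 3 ^ k * (3 * n + 0) = 3 ^ (k + 1) * n by ring]

theorem exists_T_eq (a b : ℕ) : ∃ r : Polynomial ℤ, ∀ n, 1 ≤ n →
    (T (3 ^ (2 * a + 2)) (3 ^ (2 * a + b + 1) * n - (3 ^ (2 * a + 2) - 1) / 8) : ℤ) =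
      (3 ^ (3 * a + 2 * b + 2) : ℕ) *
        coeff n (hauptmodulThree * Polynomial.aeval (27 * hauptmodulThree) r) := by
  obtain ⟨r, hr⟩ := dissect_pow_add_tripleSeries a b
  refine ⟨r, fun n hn => ?_⟩
  rw [← coeff_tripleSeries, ← coeff_dissect_pow, hr, ← nsmul_eq_mul, map_nsmul, nsmul_eq_mul]
  -- The side condition of `coeff_tripleSeries`: for `n ≥ 1` the shift is at most `3^(2a+b+1) n`, so
  -- the natural subtraction does not truncate.
  have h1 : 3 ^ (2 * a + 1) ≤ 3 ^ (2 * a + b + 1) := Nat.pow_le_pow_right (by lia) (by lia)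
  have h2 : 3 ^ (2 * a + 2) = 3 * 3 ^ (2 * a + 1) := by ring
  have h3 := Nat.le_mul_of_pos_right (3 ^ (2 * a + b + 1)) hn
  lia

theorem T_modEq_zero (n a b : ℕ) :
    T (3 ^ (2 * a + 2)) (3 ^ (2 * a + b + 1) * (n + 1) - (3 ^ (2 * a + 2) - 1) / 8)
      ≡ 0 [MOD 3 ^ (3 * a + 2 * b + 2)] := by
  obtain ⟨r, hr⟩ := exists_T_eq a b
  rw [Nat.modEq_zero_iff_dvd, ← Int.natCast_dvd_natCast, hr (n + 1) (by lia)]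
  exact dvd_mul_right _ _

theorem T_three_mul_add_two_modEq_zero (n a b : ℕ) :
    T (3 ^ (2 * a + 2)) (3 ^ (2 * a + b + 1) * (3 * n + 2) - (3 ^ (2 * a + 2) - 1) / 8)
      ≡ 0 [MOD 3 ^ (3 * a + 2 * b + 3)] := by
  obtain ⟨r, hr⟩ := exists_T_eq a b
  rw [Nat.modEq_zero_iff_dvd, ← Int.natCast_dvd_natCast, hr (3 * n + 2) (by lia),
    show 3 ^ (3 * a + 2 * b + 3) = 3 ^ (3 * a + 2 * b + 2) * 3 by ring, Nat.cast_mul]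
  exact mul_dvd_mul_left _ (three_dvd_coeff_hauptmodulThree_mul_aeval r n)

end RegularTriples

theorem theorem1p2 :
    (∀ n α β : ℕ,
      T (3 ^ (2 * α + 2)) (3 ^ (2 * α + β + 1) * (n + 1) - (3 ^ (2 * α + 2) - 1) / 8)
        ≡ 0 [MOD 3 ^ (3 * α + 2 * β + 2)]) ∧
    (∀ n α β : ℕ,
      T (3 ^ (2 * α + 2)) (3 ^ (2 * α + β + 1) * (3 * n + 2) - (3 ^ (2 * α + 2) - 1) / 8)
        ≡ 0 [MOD 3 ^ (3 * α + 2 * β + 3)]) ∧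
    (∀ l n k : ℕ, 1 ≤ k →
      T (3 ^ (2 * k))
          (3 ^ (l + 2 * k - 1) * n + 3 ^ (l + 2 * k - 1) - (3 ^ (2 * k) - 1) / 8)
        ≡ 0 [MOD 3 ^ (3 * k + 2 * l - 1)]) := by
  refine ⟨RegularTriples.T_modEq_zero, RegularTriples.T_three_mul_add_two_modEq_zero, ?_⟩
  intro l n k hk
  obtain ⟨a, rfl⟩ := Nat.exists_eq_add_of_le' hk
  have h := RegularTriples.T_modEq_zero n a l
  rw [mul_add, mul_one] at h
  rwa [show 2 * (a + 1) = 2 * a + 2 by ring, show l + (2 * a + 2) - 1 = 2 * a + l + 1 by lia,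
    show 3 * (a + 1) + 2 * l - 1 = 3 * a + 2 * l + 2 by lia]
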